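/- Let $p\in(0,1/2)$ and $n\in\mathbb N$, $n\ge 1$. All logarithms are to base $2$. For $\lambda>0$ put $\psi(\lambda)=1-\log\{(2p)^{\lambda}+(2(1-p))^{\lambda}\}$, let $\psi^{*}(\beta)=\sup_{\lambda>0}(\psi(\lambda)-\lambda\beta)$, and let $\beta(n)\in\mathbb R$ be the solution of the equation $\beta=\psi^{*}(\beta)-\frac1n$. Consider the scalar plant $Z_{t+1}=\alpha Z_t+W_t+U_t$, $t\ge 0$, where $\alpha>1$, the initial state $Z_0$ is a random variable with values in $[-\Delta,\Delta]$, the disturbances $(W_t)_{t\ge0}$ are i.i.d. with values in $[-W,W]$, and $U_t$ is the control signal. The sensor is connected to the controller by a binary symmetric channel with crossover probability $p$ and noiseless feedback, whose noise is independent of $(Z_0,(W_t)_{t\ge0})$, and which is used $n$ times between times $t$ and $t+1$ for every $t\ge0$. At each time $t$ the sensor produces one bit as a function of $Z_0,\dots,Z_t$ and of the channel outputs obtained so far; each channel input is a function of the bits produced so far and of all previous channel outputs; and at time $t$ the controller computes an estimate $\hat Z_t$ of $Z_t$ from the outputs of the first $nt$ channel uses and applies $U_t=-\alpha\hat Z_t$.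 Then, for every real $\eta\ge1$ such that $$\log\alpha\le\min\Bigl\{\frac1n,\frac{\beta(n)}{\eta}\Bigr\},$$ the plant is $\eta$-stabilizable: there is a scheme of this form (quantizers, encoders, estimators) for which $$\sup_{t\ge0}\mathbb E\bigl[|Z_t-\hat Z_t|^{\eta}\bigr]<\infty\quad\text{and}\quad \sup_{t\ge0}\mathbb E\bigl[|Z_t|^{\eta}\bigr]<\infty .$$ -/

import Mathlib

open MeasureTheory ProbabilityTheory

/-- `ψ(λ) = -log₂ ((2p)^λ + (2(1-p))^λ) + 1`. -/
noncomputable def psi (p l : ℝ) : ℝ :=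
  -Real.logb 2 ((2 * p) ^ l + (2 * (1 - p)) ^ l) + 1

/-- The transform `ψ*(β) = sup_{λ > 0} (ψ(λ) - λ β)`, as an extended real number
(the supremum is `+∞` for very negative `β`). -/
noncomputable def psiStar (p β : ℝ) : EReal :=
  ⨆ l : {l : ℝ // 0 < l}, ((psi p l - l * β : ℝ) : EReal)

/-- `β` solves the equation `β = ψ*(β) - 1/n`, i.e. `β = β(n)`. -/
def IsErrorExponent (p : ℝ) (n : ℕ) (β : ℝ) : Prop :=
  (β : EReal) = psiStar p β - ((1 / (n : ℝ) : ℝ) : EReal)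

/-- The first `k` terms of a sequence. -/
def firstTerms {A : Type*} (k : ℕ) (a : ℕ → A) : Fin k → A := fun i => a i

/-- A coding and estimation scheme with `n` channel uses per plant step. Plant steps and channel
uses are both numbered from `0`, and channel uses `n * s, …, n * s + n - 1` take place between
plant times `s` and `s + 1`.

* At plant time `s` the sensor, which has measured `Z_0, …, Z_s` and has received through the
  feedback link the channel outputs of the first `n * s` uses, produces one new bit.
* The input of channel use `k` is a function of the `k / n + 1` bits available by then and of the
  previous channel outputs, which the encoder knows by feedback.
* At plant time `t` the controller has received the outputs of the first `n * t` uses and computes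
  from them the estimate of `Z_t`. -/
structure CodingScheme (n : ℕ) where
  quantizer : (s : ℕ) → (Fin (s + 1) → ℝ) → (Fin (n * s) → Bool) → Bool
  measurable_quantizer : ∀ s y, Measurable fun z => quantizer s z y
  encoder : (k : ℕ) → (Fin (k / n + 1) → Bool) → (Fin k → Bool) → Bool
  estimator : (t : ℕ) → (Fin (n * t) → Bool) → ℝ

/-- One trajectory of the plant with gain `α` in closed loop with a scheme: `z0` is the initial
state, `w` the disturbance, `e` the channel noise (`e k = true` means that the symbol sent in use
`k` is flipped), `z` the plant state, `zhat` its estimate, `u` the control signal, `s` the bits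
produced by the sensor, and `x`, `y` the channel inputs and outputs. Given `z0`, `w`, `e`, the
equations determine the rest of the trajectory recursively. -/
structure IsTrajectory {n : ℕ} (α : ℝ) (c : CodingScheme n) (z0 : ℝ) (w : ℕ → ℝ) (e : ℕ → Bool)
    (z zhat u : ℕ → ℝ) (s x y : ℕ → Bool) : Prop where
  init : z 0 = z0
  plant : ∀ t, z (t + 1) = α * z t + w t + u t
  control : ∀ t, u t = -α * zhat t
  estimate : ∀ t, zhat t = c.estimator t (firstTerms (n * t) y)
  bit : ∀ i, s i = c.quantizer i (firstTerms (i + 1) z) (firstTerms (n * i) y)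
  input : ∀ k, x k = c.encoder k (firstTerms (k / n + 1) s) (firstTerms k y)
  channel : ∀ k, y k = xor (x k) (e k)

/-- `sup_t E |V_t|^η < ∞`. -/
def BoundedMoment {Ω : Type*} [MeasurableSpace Ω] (μ : Measure Ω) (η : ℝ) (V : ℕ → Ω → ℝ) : Prop :=
  ∃ C : ℝ, ∀ t, Integrable (fun ω => |V t ω| ^ η) μ ∧ ∫ ω, |V t ω| ^ η ∂μ ≤ C

/-- `e` is the noise of a binary symmetric channel with crossover probability `p`: symbols are
flipped independently of each other, each with probability `p`. -/
structure IsBSCNoise {Ω : Type*} [MeasurableSpace Ω] (μ : Measure Ω) (p : ℝ)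
    (e : ℕ → Ω → Bool) : Prop where
  measurable : ∀ k, Measurable (e k)
  indep : iIndepFun e μ
  flip : ∀ k, μ {ω | e k ω = true} = ENNReal.ofReal p

/-- The plant with gain `α`, initial state `Z0` and disturbances `W` is `η`-stabilizable over the
channel with noise `e`, used `n` times per plant step with feedback: for some scheme, in closed
loop with the control signal `U_t = -α Ẑ_t`, the `η`-th moments of the estimation error
`Z_t - Ẑ_t` and of the state `Z_t` are bounded uniformly in time. -/
def IsStabilizable {Ω : Type*} [MeasurableSpace Ω] (μ : Measure Ω) (n : ℕ) (α η : ℝ)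
    (Z0 : Ω → ℝ) (W : ℕ → Ω → ℝ) (e : ℕ → Ω → Bool) : Prop :=
  ∃ (c : CodingScheme n) (Z Zhat U : ℕ → Ω → ℝ) (S X Y : ℕ → Ω → Bool),
    (∀ ω, IsTrajectory α c (Z0 ω) (fun t => W t ω) (fun k => e k ω)
      (fun t => Z t ω) (fun t => Zhat t ω) (fun t => U t ω)
      (fun i => S i ω) (fun k => X k ω) (fun k => Y k ω)) ∧
    BoundedMoment μ η (fun t ω => Z t ω - Zhat t ω) ∧
    BoundedMoment μ η Z

/-! Write the controlled state as the uncontrolled state minus a shift computable from the channel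
outputs. By feedback the sensor can undo the control, and the estimation error is the error in
tracking the uncontrolled state. Divided by `α ^ t`, that state lies in shrinking cells indexed by a
path in a binary tree, one new bit every `2 * K` steps. Since `α ^ (2 * K) < 2`, halving a cell
leaves room for the disturbances (`abs_sourceState_div_sub_sourceCenter_le`).

The decoder holds a node of the same tree. Knowing this node by feedback, the encoder sends in each
block of `K` steps a two-bit instruction moving it towards the source node, each bit repeated `m`
times. A good block reduces the tree distance by one, a bad block increases it by at most one, and
every second block the source adds one. So the distance is at most `lag`, a reflected walk driven by
the noise alone (`treeNear_walk`). A lag `d` costs an error of order `A ^ d` with `A = α ^ (2 * K)`,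
so the `η`-th moment reduces to `E[(A ^ η) ^ lag]`, which is bounded when block errors are rare
(`exists_integral_pow_lag_le`).

The exponent enters only through two consequences of `β + 1 / n ≤ sup ψ`: `psi_le_neg_logb` makes `4
* p * (1 - p)` at most `2 ^ (-8 * (β + 1 / n))`, and `psi_le_one_sub_logb` gives `β + 1 / n < 1`.
With `η * logb 2 α ≤ β`, the first makes block errors rare enough. -/

/-! ### Walking on a binary tree

Nodes of the binary tree are lists of bits, the last bit first. -/

/-- The effect of an instruction: append a bit, go back to the parent, or stay. -/
def treeMove (v : List Bool) : Bool × Bool → List Bool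
  | (true, b) => b :: v
  | (false, true) => v.tail
  | (false, false) => v

/-- The instruction that brings `v` one step closer to `τ`. -/
def treeInstruction (τ v : List Bool) : Bool × Bool :=
  if (true :: v) <:+ τ then (true, true)
  else if (false :: v) <:+ τ then (true, false)
  else if v = τ then (false, false) else (false, true)

/-- The tree distance between `v` and `τ` is at most `d`. -/
def TreeNear (d : ℕ) (v τ : List Bool) : Prop :=
  ∃ w, w <:+ v ∧ w <:+ τ ∧ v.length + τ.length ≤ 2 * w.length + d

theorem TreeNear.treeMove_instruction {d : ℕ} {v τ : List Bool} (h : TreeNear d v τ) :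
    TreeNear (d - 1) (treeMove v (treeInstruction τ v)) τ := by
  obtain ⟨w, hwv, hwt, hl⟩ := h
  have hwl := hwv.length_le
  have hwt' := hwt.length_le
  unfold treeInstruction
  split_ifs with h1 h2 h3
  · have := h1.length_le
    exact ⟨true :: v, List.suffix_refl _, h1, by simp [treeMove] at *; omega⟩
  · have := h2.length_le
    exact ⟨false :: v, List.suffix_refl _, h2, by simp [treeMove] at *; omega⟩
  · subst h3
    exact ⟨v, List.suffix_refl _, List.suffix_refl _, by simp [treeMove]; omega⟩
  -- A suffix of `τ` is either `τ` itself or extends by the next bit of `τ`, and both cases are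
  -- excluded. So the common ancestor is a proper ancestor of `v` and survives the step back.
  · have hns : ¬ v <:+ τ := by
      rintro ⟨u, hu⟩
      rcases List.eq_nil_or_concat u with rfl | ⟨u', b, rfl⟩
      · exact h3 (by simpa using hu)
      · cases b
        · exact h2 ⟨u', by simpa using hu⟩
        · exact h1 ⟨u', by simpa using hu⟩
    cases v with
    | nil => exact absurd (List.nil_suffix) hns
    | cons b v =>
      rcases List.suffix_cons_iff.1 hwv with rfl | hw
      · exact absurd hwt hns
      · have := hw.length_le
        exact ⟨w, hw, hwt, by simp [treeMove] at *; omega⟩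

theorem TreeNear.treeMove {d : ℕ} {v τ : List Bool} (h : TreeNear d v τ) (σ : Bool × Bool) :
    TreeNear (d + 1) (treeMove v σ) τ := by
  obtain ⟨w, hwv, hwt, hl⟩ := h
  match σ with
  | (true, b) =>
    exact ⟨w, hwv.trans (List.suffix_cons _ _), hwt, by simp [_root_.treeMove]; omega⟩
  | (false, false) => exact ⟨w, hwv, hwt, by simp [_root_.treeMove]; omega⟩
  | (false, true) =>
    cases v with
    | nil => exact ⟨w, hwv, hwt, by simp [_root_.treeMove] at *; omega⟩
    | cons b v =>
      rcases List.suffix_cons_iff.1 hwv with rfl | hw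
      · exact ⟨v, List.suffix_refl _, (List.suffix_cons _ _).trans hwt,
          by simp [_root_.treeMove] at *; omega⟩
      · exact ⟨w, hw, hwt, by simp [_root_.treeMove] at *; omega⟩

theorem TreeNear.cons {d : ℕ} {v τ : List Bool} (h : TreeNear d v τ) (b : Bool) :
    TreeNear (d + 1) v (b :: τ) := by
  obtain ⟨w, hwv, hwt, hl⟩ := h
  exact ⟨w, hwv, hwt.trans (List.suffix_cons _ _), by simp; omega⟩

/-- The center of the cell of a node: the cells at depth `i` have radius about `L / A ^ i`. -/
noncomputable def center (A L : ℝ) : List Bool → ℝ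
  | [] => 0
  | b :: v => center A L v + (if b then 1 else -1) * (L / 2 / A ^ v.length)

/-- The right side is the geometric sum of the displacements `L / 2 / A ^ k` along the path from `w`
to `v`. -/
theorem abs_center_sub_le {A L : ℝ} (hA : 1 < A) (hL : 0 ≤ L) {w v : List Bool} (h : w <:+ v) :
    |center A L v - center A L w| ≤
      L / 2 * (A / (A - 1)) * (1 / A ^ w.length - 1 / A ^ v.length) := by
  obtain ⟨u, rfl⟩ := h
  induction u with
  | nil => simp
  | cons b u ih =>
    have hA0 : 0 < A := by linarith
    have hA1 : A - 1 ≠ 0 := by linarith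
    have hsplit : center A L (b :: u ++ w) - center A L w =
        (if b then 1 else -1) * (L / 2 / A ^ (u ++ w).length) +
          (center A L (u ++ w) - center A L w) := by
      simp [center]; ring
    have hb : |(if b then (1 : ℝ) else -1) * (L / 2 / A ^ (u ++ w).length)| =
        L / 2 / A ^ (u ++ w).length := by
      have : 0 ≤ L / 2 / A ^ (u ++ w).length := by positivity
      cases b <;> simp only [Bool.false_eq_true, if_true, if_false, one_mul, neg_one_mul, abs_neg] <;>
        exact abs_of_nonneg this
    rw [hsplit]
    refine (abs_add_le _ _).trans ?_
    rw [hb]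
    have hlen : (b :: u ++ w).length = (u ++ w).length + 1 := by simp
    rw [hlen]
    refine (add_le_add_right ih _).trans (le_of_eq ?_)
    have : A ^ (u ++ w).length ≠ 0 := by positivity
    have : A ^ w.length ≠ 0 := by positivity
    rw [pow_succ]
    field_simp
    ring

/-- Both centers are compared with that of the common ancestor, whose depth is at least `τ.length -
d`. -/
theorem TreeNear.abs_center_sub_le {A L : ℝ} (hA : 1 < A) (hL : 0 ≤ L) {d : ℕ} {v τ : List Bool}
    (h : TreeNear d v τ) :
    |center A L v - center A L τ| ≤ L * (A / (A - 1)) * (A ^ d / A ^ τ.length) := by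
  obtain ⟨w, hwv, hwt, hl⟩ := h
  have h1 := _root_.abs_center_sub_le hA hL hwv
  have h2 := _root_.abs_center_sub_le hA hL hwt
  have hA0 : 0 < A := by linarith
  have hwl := hwv.length_le
  have hc : 0 ≤ L / 2 * (A / (A - 1)) := by
    have : 0 < A - 1 := by linarith
    positivity
  have hw : 1 / A ^ w.length ≤ A ^ d / A ^ τ.length := by
    rw [div_le_div_iff₀ (by positivity) (by positivity), one_mul, ← pow_add]
    exact pow_le_pow_right₀ hA.le (by omega)
  have hv : 0 ≤ 1 / A ^ v.length := by positivity
  have ht : 0 ≤ 1 / A ^ τ.length := by positivity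
  have h3 : |center A L v - center A L τ| ≤
      |center A L v - center A L w| + |center A L τ - center A L w| := by
    rw [abs_sub_comm (center A L τ)]; exact abs_sub_le _ _ _
  have h4 : L / 2 * (A / (A - 1)) * (1 / A ^ w.length - 1 / A ^ v.length) ≤
      L / 2 * (A / (A - 1)) * (A ^ d / A ^ τ.length) :=
    mul_le_mul_of_nonneg_left (by linarith) hc
  have h5 : L / 2 * (A / (A - 1)) * (1 / A ^ w.length - 1 / A ^ τ.length) ≤
      L / 2 * (A / (A - 1)) * (A ^ d / A ^ τ.length) :=
    mul_le_mul_of_nonneg_left (by linarith) hc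
  linarith

/-! ### Repetition codes -/

/-- The majority of the first `m` bits. -/
def majority (m : ℕ) (y : ℕ → Bool) : Bool :=
  decide (m < 2 * ((Finset.range m).filter fun i => y i = true).card)

/-- At least half of the first `m` bits are flipped. -/
def halfFlipped (m : ℕ) (e : ℕ → Bool) : Bool :=
  decide (m ≤ 2 * ((Finset.range m).filter fun i => e i = true).card)

theorem majority_congr {m : ℕ} {y y' : ℕ → Bool} (h : ∀ i < m, y i = y' i) :
    majority m y = majority m y' := by
  unfold majority
  rw [Finset.filter_congr (q := fun i => y' i = true)]
  intro i hi
  rw [h i (Finset.mem_range.1 hi)]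

theorem halfFlipped_congr {m : ℕ} {y y' : ℕ → Bool} (h : ∀ i < m, y i = y' i) :
    halfFlipped m y = halfFlipped m y' := by
  unfold halfFlipped
  rw [Finset.filter_congr (q := fun i => y' i = true)]
  intro i hi
  rw [h i (Finset.mem_range.1 hi)]

theorem majority_xor {m : ℕ} {e : ℕ → Bool} (h : halfFlipped m e = false) (a : Bool) :
    majority m (fun i => xor a (e i)) = a := by
  simp only [halfFlipped, decide_eq_false_iff_not, not_le] at h
  cases a
  · simp only [majority, Bool.false_xor, decide_eq_false_iff_not]; omega
  · have := Finset.card_filter_add_card_filter_not (s := Finset.range m) (fun i => e i = true)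
    simp only [majority, Bool.true_xor, decide_eq_true_eq]
    simp only [Finset.card_range, Bool.not_eq_true] at this
    simp only [Bool.not_eq_true', ]
    omega

/-- The bits received for block `j`: each of two bits is repeated `m` times, at the beginning of a
block of `N` channel uses. -/
def decodeBlock (N m : ℕ) (y : ℕ → Bool) (j : ℕ) : Bool × Bool :=
  (majority m fun i => y (N * j + i), majority m fun i => y (N * j + m + i))

/-- The noise may corrupt block `j`. -/
def blockError (N m : ℕ) (e : ℕ → Bool) (j : ℕ) : Bool :=
  (halfFlipped m fun i => e (N * j + i)) || (halfFlipped m fun i => e (N * j + m + i))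

theorem decodeBlock_congr {N m : ℕ} (hm : 2 * m ≤ N) {y y' : ℕ → Bool} {j : ℕ}
    (h : ∀ k < N * (j + 1), y k = y' k) : decodeBlock N m y j = decodeBlock N m y' j := by
  unfold decodeBlock
  rw [Nat.mul_succ] at h
  rw [majority_congr fun i hi => h (N * j + i) (by omega),
    majority_congr fun i hi => h (N * j + m + i) (by omega)]

theorem blockError_congr {N m : ℕ} {e e' : ℕ → Bool} {j j' : ℕ}
    (h : ∀ i < 2 * m, e (N * j + i) = e' (N * j' + i)) :
    blockError N m e j = blockError N m e' j' := by
  unfold blockError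
  rw [halfFlipped_congr (y := fun i => e (N * j + i)) (y' := fun i => e' (N * j' + i)) fun i hi => h i (by omega),
    halfFlipped_congr (y := fun i => e (N * j + m + i)) (y' := fun i => e' (N * j' + m + i)) fun i hi => by
      simpa only [add_assoc] using h (m + i) (by omega)]

/-! ### The encoder and the decoder -/

/-- The node reached by the first `i` of a sequence of bits. -/
def bitList (b : ℕ → Bool) : ℕ → List Bool
  | 0 => []
  | i + 1 => b i :: bitList b i

theorem length_bitList (b : ℕ → Bool) (i : ℕ) : (bitList b i).length = i := by
  induction i with
  | zero => rfl
  | succ i ih => simp [bitList, ih]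

theorem bitList_congr {b b' : ℕ → Bool} {i : ℕ} (h : ∀ k < i, b k = b' k) :
    bitList b i = bitList b' i := by
  induction i with
  | zero => rfl
  | succ i ih => rw [bitList, bitList, h i (by omega), ih fun k hk => h k (by omega)]

/-- The node of the decoder before block `j`, as a function of the channel outputs. -/
def decodedNode (N m : ℕ) (y : ℕ → Bool) : ℕ → List Bool
  | 0 => []
  | j + 1 => treeMove (decodedNode N m y j) (decodeBlock N m y j)

theorem decodedNode_congr {N m : ℕ} (hm : 2 * m ≤ N) {y y' : ℕ → Bool} {j : ℕ}
    (h : ∀ k < N * j, y k = y' k) : decodedNode N m y j = decodedNode N m y' j := by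
  induction j with
  | zero => rfl
  | succ j ih =>
    rw [decodedNode, decodedNode, decodeBlock_congr hm h,
      ih fun k hk => h k (hk.trans_le (Nat.mul_le_mul_left _ (by omega)))]

/-- The channel input in use `k`, if the decoder is at the node `v j` before block `j`. -/
def channelInput (N m : ℕ) (b : ℕ → Bool) (v : ℕ → List Bool) (k : ℕ) : Bool :=
  if k % N < m then (treeInstruction (bitList b (k / N / 2 + 1)) (v (k / N))).1
  else (treeInstruction (bitList b (k / N / 2 + 1)) (v (k / N))).2

/-- The node of the decoder before block `j`, as a function of the source bits and the noise. -/
def walk (N m : ℕ) (b e : ℕ → Bool) : ℕ → List Bool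
  | 0 => []
  | j + 1 =>
    treeMove (walk N m b e j)
      (majority m fun i => xor (treeInstruction (bitList b (j / 2 + 1)) (walk N m b e j)).1
          (e (N * j + i)),
        majority m fun i => xor (treeInstruction (bitList b (j / 2 + 1)) (walk N m b e j)).2
          (e (N * j + m + i)))

/-- The channel output in use `k`, as a function of the source bits and the noise. -/
def channelOutput (N m : ℕ) (b e : ℕ → Bool) (k : ℕ) : Bool :=
  xor (channelInput N m b (walk N m b e) k) (e k)

/-- Closes the feedback loop: the node read off the outputs is the one for which the encoder chose
its instructions. -/
theorem decodedNode_channelOutput {N m : ℕ} (hm : 2 * m ≤ N) (b e : ℕ → Bool) (j : ℕ) :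
    decodedNode N m (channelOutput N m b e) j = walk N m b e j := by
  induction j with
  | zero => rfl
  | succ j ih =>
    rw [decodedNode, walk, ih, decodeBlock]
    congr 2
    · refine majority_congr fun i hi => ?_
      have h1 : (N * j + i) / N = j := by
        rw [Nat.mul_add_div (by omega), Nat.div_eq_of_lt (by omega), add_zero]
      have h2 : (N * j + i) % N = i := by
        rw [Nat.mul_add_mod, Nat.mod_eq_of_lt (by omega)]
      simp [channelOutput, channelInput, h1, h2, hi]
    · refine majority_congr fun i hi => ?_
      have h1 : (N * j + m + i) / N = j := by
        rw [add_assoc, Nat.mul_add_div (by omega), Nat.div_eq_of_lt (by omega), add_zero]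
      have h2 : (N * j + m + i) % N = m + i := by
        rw [add_assoc, Nat.mul_add_mod, Nat.mod_eq_of_lt (by omega)]
      simp [channelOutput, channelInput, h1, h2]

/-- A bound on the distance between the decoder and the source before block `j`. -/
def lag (N m : ℕ) (e : ℕ → Bool) : ℕ → ℕ
  | 0 => 1
  | j + 1 => (if blockError N m e j then lag N m e j + 1 else lag N m e j - 1) + j % 2

theorem lag_congr {N m : ℕ} (hm : 2 * m ≤ N) {e e' : ℕ → Bool} {j : ℕ}
    (h : ∀ k < N * j, e k = e' k) : lag N m e j = lag N m e' j := by
  induction j with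
  | zero => rfl
  | succ j ih =>
    rw [lag, lag, ih fun k hk => h k (hk.trans_le (Nat.mul_le_mul_left _ (by omega))),
      blockError_congr (j' := j)]
    intro i hi
    exact h _ (by rw [Nat.mul_succ]; omega)

theorem lag_le (N m : ℕ) (e : ℕ → Bool) (j : ℕ) : lag N m e j ≤ 1 + 2 * j := by
  induction j with
  | zero => simp [lag]
  | succ j ih => rw [lag]; split_ifs <;> omega

theorem treeNear_walk (N m : ℕ) (b e : ℕ → Bool) (j : ℕ) :
    TreeNear (lag N m e j) (walk N m b e j) (bitList b (j / 2 + 1)) := by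
  induction j with
  -- The lag starts at 1: the source already has its first bit while the decoder is at the root.
  | zero => exact ⟨[], List.nil_suffix, List.nil_suffix, by simp [walk, bitList, lag]⟩
  | succ j ih =>
    have key : TreeNear (if blockError N m e j then lag N m e j + 1 else lag N m e j - 1)
        (walk N m b e (j + 1)) (bitList b (j / 2 + 1)) := by
      rw [walk]
      split_ifs with h
      · exact ih.treeMove _
      · simp only [blockError, Bool.or_eq_true, not_or, Bool.not_eq_true] at h
        rw [majority_xor h.1, majority_xor h.2]
        exact ih.treeMove_instruction
    rw [lag]
    rcases Nat.mod_two_eq_zero_or_one j with h | h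
    · rw [h, show (j + 1) / 2 = j / 2 by omega]
      exact key
    · rw [h, show (j + 1) / 2 = j / 2 + 1 by omega, bitList]
      exact key.cons _

/-! ### Bounds on the error exponent -/

/-- Differentiating in `u` reduces this to `l * tanh u ≤ tanh (l * u)`. With denominators cleared, a
second differentiation leaves `(1 - l ^ 2) * sinh (l * u) * sinh u ≥ 0`. -/
theorem sq_mul_log_cosh_le {l : ℝ} (hl0 : 0 ≤ l) (hl1 : l ≤ 1) {u : ℝ} (hu : 0 ≤ u) :
    l ^ 2 * Real.log (Real.cosh u) ≤ Real.log (Real.cosh (l * u)) := by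
  have hsinh : MonotoneOn
      (fun x => Real.sinh (l * x) * Real.cosh x - l * (Real.sinh x * Real.cosh (l * x)))
      (Set.Ici 0) := by
    refine monotoneOn_of_hasDerivWithinAt_nonneg (convex_Ici 0)
      (f' := fun x => (1 - l ^ 2) * (Real.sinh (l * x) * Real.sinh x)) (by fun_prop) ?_ ?_
    · intro x _
      have h1 : HasDerivAt (fun x => l * x) l x := by simpa using (hasDerivAt_id x).const_mul l
      have := ((h1.sinh.mul (Real.hasDerivAt_cosh x)).sub
        (((Real.hasDerivAt_sinh x).mul h1.cosh).const_mul l)).hasDerivWithinAt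
        (s := interior (Set.Ici 0))
      exact this.congr_deriv (by ring)
    · intro x hx
      rw [interior_Ici, Set.mem_Ioi] at hx
      have h1 : 0 ≤ Real.sinh (l * x) := Real.sinh_nonneg_iff.2 (by positivity)
      have h2 : 0 ≤ Real.sinh x := Real.sinh_nonneg_iff.2 hx.le
      have h3 : 0 ≤ 1 - l ^ 2 := by nlinarith
      positivity
  have hlog : MonotoneOn
      (fun x => Real.log (Real.cosh (l * x)) - l ^ 2 * Real.log (Real.cosh x)) (Set.Ici 0) := by
    refine monotoneOn_of_hasDerivWithinAt_nonneg (convex_Ici 0)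
      (f' := fun x => l * Real.sinh (l * x) / Real.cosh (l * x) -
        l ^ 2 * (Real.sinh x / Real.cosh x)) ?_ ?_ ?_
    · refine Continuous.continuousOn ?_
      refine Continuous.sub (Continuous.log (by fun_prop) fun x => (Real.cosh_pos _).ne') ?_
      exact continuous_const.mul (Continuous.log (by fun_prop) fun x => (Real.cosh_pos _).ne')
    · intro x _
      have h1 : HasDerivAt (fun x => l * x) l x := by simpa using (hasDerivAt_id x).const_mul l
      have := ((h1.cosh.log (Real.cosh_pos _).ne').sub
        (((Real.hasDerivAt_cosh x).log (Real.cosh_pos _).ne').const_mul (l ^ 2))).hasDerivWithinAt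
        (s := interior (Set.Ici 0))
      exact this.congr_deriv (by ring)
    · intro x hx
      rw [interior_Ici, Set.mem_Ioi] at hx
      have h0 := hsinh Set.self_mem_Ici (Set.mem_Ici.2 hx.le) hx.le
      simp only [mul_zero, Real.sinh_zero, zero_mul, sub_zero] at h0
      have hc1 := Real.cosh_pos (l * x)
      have hc2 := Real.cosh_pos x
      have : l * Real.sinh (l * x) / Real.cosh (l * x) - l ^ 2 * (Real.sinh x / Real.cosh x) =
          l * (Real.sinh (l * x) * Real.cosh x - l * (Real.sinh x * Real.cosh (l * x))) /
            (Real.cosh (l * x) * Real.cosh x) := by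
        field_simp
      rw [this]
      positivity
  have := hlog Set.self_mem_Ici (Set.mem_Ici.2 hu) hu
  simp only [mul_zero, Real.cosh_zero, Real.log_one, sub_zero] at this
  linarith

theorem two_le_rpow_add_rpow {p l : ℝ} (hp0 : 0 < p) (hp : p < 1 / 2) (hl : 1 ≤ l) :
    2 ≤ (2 * p) ^ l + (2 * (1 - p)) ^ l := by
  have h1 := one_add_mul_self_le_rpow_one_add (s := 2 * p - 1) (by linarith) hl
  have h2 := one_add_mul_self_le_rpow_one_add (s := 1 - 2 * p) (by linarith) hl
  rw [show 1 + (2 * p - 1) = 2 * p by ring] at h1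
  rw [show 1 + (1 - 2 * p) = 2 * (1 - p) by ring] at h2
  nlinarith

/-- For `l ≥ 1`, Bernoulli's inequality gives `ψ ≤ 0`. For `l ≤ 1`, the substitution `2p = exp (-u)
/ cosh u`, `2(1-p) = exp u / cosh u` turns `ψ` into `l * log (cosh u) - log (cosh (l * u))` up to
the base, while `4p(1-p) = (cosh u)⁻²`. -/
theorem psi_le_neg_logb {p l : ℝ} (hp0 : 0 < p) (hp : p < 1 / 2) (hl : 0 < l) :
    psi p l ≤ -(1 / 8) * Real.logb 2 (4 * p * (1 - p)) := by
  have hq0 : 0 < 1 - p := by linarith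
  have h4 : 4 * p * (1 - p) ≤ 1 := by nlinarith [sq_nonneg (1 - 2 * p)]
  have h40 : 0 < 4 * p * (1 - p) := by positivity
  have hlog4 : Real.log (4 * p * (1 - p)) ≤ 0 := Real.log_nonpos h40.le h4
  have hlog2 : 0 < Real.log 2 := Real.log_pos (by norm_num)
  suffices h : Real.log 2 + 1 / 8 * Real.log (4 * p * (1 - p)) ≤
      Real.log ((2 * p) ^ l + (2 * (1 - p)) ^ l) by
    rw [psi, Real.logb, Real.logb]
    rw [← sub_nonneg]
    have : -(1 / 8) * (Real.log (4 * p * (1 - p)) / Real.log 2) -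
        (-(Real.log ((2 * p) ^ l + (2 * (1 - p)) ^ l) / Real.log 2) + 1) =
        (Real.log ((2 * p) ^ l + (2 * (1 - p)) ^ l) -
          (Real.log 2 + 1 / 8 * Real.log (4 * p * (1 - p)))) / Real.log 2 := by
      field_simp
      ring
    rw [this]
    exact div_nonneg (by linarith) hlog2.le
  rcases le_total 1 l with h1 | h1
  · have := Real.log_le_log (by norm_num) (two_le_rpow_add_rpow hp0 hp h1)
    linarith
  · set u := Real.log ((1 - p) / p) / 2 with hu
    have hu0 : 0 ≤ u := by
      have : 0 ≤ Real.log ((1 - p) / p) := Real.log_nonneg (by rw [le_div_iff₀ hp0]; linarith)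
      positivity
    have hc : 0 < Real.cosh u := Real.cosh_pos u
    have hsq : Real.exp u * Real.exp u = (1 - p) / p := by
      rw [← Real.exp_add, hu, add_halves, Real.exp_log (by positivity)]
    have he : 0 < Real.exp u := Real.exp_pos u
    have hce : 2 * Real.cosh u * Real.exp u = 1 / p := by
      rw [Real.cosh_eq, Real.exp_neg]
      field_simp
      rw [pow_two, hsq]
      field_simp
      ring
    have h2p : 2 * p = Real.exp (-u) / Real.cosh u := by
      rw [Real.exp_neg]
      field_simp
      field_simp at hce
      linarith
    have h2q : 2 * (1 - p) = Real.exp u / Real.cosh u := by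
      have : 1 - p = p * (Real.exp u * Real.exp u) := by rw [hsq]; field_simp
      rw [this, eq_div_iff hc.ne']
      field_simp at hce
      linear_combination Real.exp u * hce
    have hsum : (2 * p) ^ l + (2 * (1 - p)) ^ l = 2 * Real.cosh (l * u) / Real.cosh u ^ l := by
      rw [h2p, h2q, Real.div_rpow (Real.exp_pos _).le hc.le, Real.div_rpow he.le hc.le,
        ← Real.exp_mul, ← Real.exp_mul, Real.cosh_eq (l * u)]
      rw [show -u * l = -(l * u) by ring, show u * l = l * u by ring]
      ring
    have hprod : 4 * p * (1 - p) = (Real.cosh u ^ 2)⁻¹ := by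
      rw [show 4 * p * (1 - p) = (2 * p) * (2 * (1 - p)) by ring, h2p, h2q, Real.exp_neg]
      field_simp
    rw [hsum, hprod, Real.log_inv, Real.log_div (by positivity) (by positivity),
      Real.log_mul (by norm_num) (Real.cosh_pos _).ne', Real.log_rpow hc,
      Real.log_pow]
    have hlc := sq_mul_log_cosh_le hl.le h1 hu0
    have hlc0 : 0 ≤ Real.log (Real.cosh u) := Real.log_nonneg (Real.one_le_cosh u)
    push_cast
    -- The constant `1 / 8` is half the maximum `1 / 4` of `l - l ^ 2`.
    nlinarith [mul_nonneg hlc0 (sq_nonneg (l - 1 / 2))]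

theorem psi_le_one_sub_logb {p l : ℝ} (hp0 : 0 < p) (hp : p < 1 / 2) (hl : 0 < l) :
    psi p l ≤ 1 - Real.logb 2 (1 + 2 * p) := by
  have : 1 + 2 * p ≤ (2 * p) ^ l + (2 * (1 - p)) ^ l := by
    rcases le_total 1 l with h1 | h1
    · linarith [two_le_rpow_add_rpow hp0 hp h1]
    · have h2 := Real.rpow_le_rpow_of_exponent_ge (by linarith) (by linarith : 2 * p ≤ 1) h1
      have h3 := Real.one_le_rpow (by linarith : 1 ≤ 2 * (1 - p)) hl.le
      rw [Real.rpow_one] at h2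
      linarith
  have := Real.logb_le_logb_of_le (by norm_num : (1 : ℝ) < 2) (by linarith) this
  rw [psi]
  linarith

/-- For `β ≥ 0` the term `-λβ` only lowers the supremum, so a uniform bound on `ψ` also bounds
`ψ*(β)`. -/
theorem IsErrorExponent.add_le {p β M : ℝ} {n : ℕ} (h : IsErrorExponent p n β) (hβ : 0 ≤ β)
    (hM : ∀ l, 0 < l → psi p l ≤ M) : β + 1 / n ≤ M := by
  have h1 : psiStar p β ≤ (M : EReal) := by
    refine iSup_le fun l => EReal.coe_le_coe_iff.2 ?_
    have := mul_nonneg l.2.le hβ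
    linarith [hM l l.2]
  have h2 : (β : EReal) ≤ (M : EReal) - ((1 / (n : ℝ) : ℝ) : EReal) := by
    rw [IsErrorExponent] at h
    rw [h]
    exact EReal.sub_le_sub h1 le_rfl
  rw [← EReal.coe_sub, EReal.coe_le_coe_iff] at h2
  linarith

/-! ### Moments of the lag -/

/-- The extension of a finite sequence by a default value. -/
def extendSeq {A : Type*} [Inhabited A] {k : ℕ} (a : Fin k → A) : ℕ → A :=
  fun i => if h : i < k then a ⟨i, h⟩ else default

theorem extendSeq_firstTerms {A : Type*} [Inhabited A] (a : ℕ → A) {k i : ℕ} (h : i < k) :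
    extendSeq (firstTerms k a) i = a i := by
  simp [extendSeq, firstTerms, h]

theorem measurable_of_firstTerms {Ω A γ : Type*} [MeasurableSpace Ω] [MeasurableSpace A]
    [MeasurableSpace γ] [Inhabited A] [Finite A] [DiscreteMeasurableSpace A] {a : ℕ → Ω → A}
    (ha : ∀ k, Measurable (a k)) {F : (ℕ → A) → γ} {M : ℕ}
    (hF : ∀ x x', (∀ k < M, x k = x' k) → F x = F x') :
    Measurable fun ω => F fun k => a k ω := by
  have : (fun ω => F fun k => a k ω) =
      (fun f : Fin M → A => F (extendSeq f)) ∘ fun ω i => a i ω := by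
    funext ω
    exact hF _ _ fun k hk => (extendSeq_firstTerms (fun k => a k ω) hk).symm
  rw [this]
  exact (Measurable.of_discrete).comp (measurable_pi_lambda _ fun i => ha i)

section Noise

variable {Ω : Type*} [MeasurableSpace Ω] {μ : Measure Ω}
  {p : ℝ} {e : ℕ → Ω → Bool}

theorem IsBSCNoise.real_flip (he : IsBSCNoise μ p e) (hp0 : 0 ≤ p) (k : ℕ) :
    μ.real {ω | e k ω = true} = p := by
  rw [measureReal_def, he.flip, ENNReal.toReal_ofReal hp0]

theorem measurable_lag {N m : ℕ} (hm : 2 * m ≤ N) (he : ∀ k, Measurable (e k)) (j : ℕ) :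
    Measurable fun ω => lag N m (fun k => e k ω) j :=
  measurable_of_firstTerms he (F := fun x => lag N m x j) (M := N * j) fun _ _ h => lag_congr hm h

theorem measurable_blockError {N m : ℕ} (he : ∀ k, Measurable (e k)) (j : ℕ) :
    Measurable fun ω => blockError N m (fun k => e k ω) j :=
  measurable_of_firstTerms he (F := fun x => blockError N m x j) (M := N * j + 2 * m)
    fun _ _ h => blockError_congr fun i hi => h _ (by omega)

/-- The two variables read disjoint sets of channel uses: those before block `j`, and the first `2 *
m` inside it. -/
theorem indepFun_lag_blockError {N m : ℕ} (hm : 2 * m ≤ N) (he : ∀ k, Measurable (e k))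
    (hind : iIndepFun e μ) (j : ℕ) :
    IndepFun (fun ω => lag N m (fun k => e k ω) j) (fun ω => blockError N m (fun k => e k ω) j)
      μ := by
  classical
  have h := hind.indepFun_finset (Finset.range (N * j)) (Finset.Ico (N * j) (N * j + 2 * m))
    (by
      rw [Finset.disjoint_left]
      intro i hi hi'
      rw [Finset.mem_range] at hi
      rw [Finset.mem_Ico] at hi'
      omega) he
  have h' := h.comp
    (φ := fun f => lag N m (fun k => if hk : k ∈ Finset.range (N * j) then f ⟨k, hk⟩ else false) j)
    (ψ := fun f => blockError N m
      (fun k => if hk : k ∈ Finset.Ico (N * j) (N * j + 2 * m) then f ⟨k, hk⟩ else false) j)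
    Measurable.of_discrete Measurable.of_discrete
  convert h' using 1
  · funext ω
    exact lag_congr hm fun k hk => by simp [hk]
  · funext ω
    refine (blockError_congr (e' := fun k => if hk : k ∈ Finset.Ico (N * j) (N * j + 2 * m) then
      e k ω else false) fun i hi => ?_)
    have : N * j + i ∈ Finset.Ico (N * j) (N * j + 2 * m) := Finset.mem_Ico.2 (by omega)
    rw [dif_pos this]

variable [IsProbabilityMeasure μ]

theorem IsBSCNoise.integral_comp (he : IsBSCNoise μ p e) (hp0 : 0 ≤ p) (k : ℕ) (g : Bool → ℝ) :
    ∫ ω, g (e k ω) ∂μ = p * g true + (1 - p) * g false := by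
  have hm : MeasurableSet {ω | e k ω = true} := he.measurable k (measurableSet_singleton true)
  have : (fun ω => g (e k ω)) =
      fun ω => g false + {ω | e k ω = true}.indicator (fun _ => g true - g false) ω := by
    funext ω
    by_cases h : e k ω = true <;> simp [h]
  rw [this, integral_add (integrable_const _) ((integrable_const _).indicator hm),
    integral_indicator_const _ hm, he.real_flip hp0]
  simp
  ring

/-- Chernoff bound: weight a flip by `a` and a correct symbol by `a⁻¹`. As `a ≥ 1`, the product is
at least 1 when half the symbols are flipped. The choice `a = √((1 - p) / p)` minimizes the mean `p
* a + (1 - p) / a`. -/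
theorem IsBSCNoise.real_halfFlipped_le (he : IsBSCNoise μ p e) (hp0 : 0 < p) (hp : p < 1 / 2)
    (m s : ℕ) :
    μ.real {ω | halfFlipped m (fun i => e (s + i) ω) = true} ≤ √(4 * p * (1 - p)) ^ m := by
  have hq0 : 0 < 1 - p := by linarith
  set a := √((1 - p) / p) with ha
  have ha1 : 1 ≤ a := Real.one_le_sqrt.2 (by rw [le_div_iff₀ hp0]; linarith)
  have ha0 : 0 < a := by linarith
  have hasq : p * a ^ 2 = 1 - p := by
    rw [ha, Real.sq_sqrt (by positivity)]; field_simp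
  set g : Bool → ℝ := fun b => if b then a else a⁻¹ with hg
  have hmean : p * g true + (1 - p) * g false = √(4 * p * (1 - p)) := by
    symm
    rw [Real.sqrt_eq_iff_mul_self_eq (by positivity) (by simp [hg]; positivity)]
    simp only [hg, if_true, Bool.false_eq_true, if_false]
    rw [← hasq]
    field_simp
    ring
  have hind : iIndepFun (fun i : Fin m => e (s + i)) μ :=
    he.indep.precomp (g := fun i : Fin m => s + (i : ℕ)) fun i j h => Fin.ext (by simpa using h)
  have hprod : ∫ ω, ∏ i : Fin m, g (e (s + i) ω) ∂μ = √(4 * p * (1 - p)) ^ m := by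
    have h1 := (hind.comp (fun _ => g) fun _ => Measurable.of_discrete)
    have := h1.integral_fun_prod_eq_prod_integral fun i =>
      ((Measurable.of_discrete (f := g)).comp (he.measurable _)).aestronglyMeasurable
    simp only [Function.comp_apply] at this
    rw [this]
    simp [he.integral_comp hp0.le, hmean]
  rw [← hprod]
  have hset : MeasurableSet {ω | halfFlipped m (fun i => e (s + i) ω) = true} := by
    have : Measurable fun ω => halfFlipped m (fun i => e (s + i) ω) :=
      measurable_of_firstTerms (a := fun i => e (s + i)) (fun i => he.measurable _)
        (F := halfFlipped m) (M := m) fun x x' h => halfFlipped_congr h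
    exact this (measurableSet_singleton true)
  rw [← integral_indicator_one hset]
  have hgm : Measurable fun ω => ∏ i : Fin m, g (e (s + i) ω) :=
    Finset.measurable_fun_prod _ fun i _ => (Measurable.of_discrete (f := g)).comp (he.measurable _)
  have hg0 : ∀ b, 0 ≤ g b := by intro b; cases b <;> simp [hg] <;> positivity
  have hga : ∀ b, g b ≤ a := by
    intro b; cases b <;> simp only [hg, if_true, Bool.false_eq_true, if_false, le_refl]
    exact (inv_le_one_of_one_le₀ ha1).trans ha1
  refine integral_mono_of_nonneg (ae_of_all _ fun ω => Set.indicator_nonneg (by simp) ω) ?_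
    (ae_of_all _ fun ω => ?_)
  · refine Integrable.of_bound hgm.aestronglyMeasurable (a ^ m) (ae_of_all _ fun ω => ?_)
    rw [Real.norm_of_nonneg (Finset.prod_nonneg fun i _ => hg0 _)]
    calc _ ≤ ∏ i : Fin m, a := Finset.prod_le_prod (fun i _ => hg0 _) fun i _ => hga _
      _ = a ^ m := by simp
  · by_cases h : halfFlipped m (fun i => e (s + i) ω) = true
    · rw [Set.indicator_of_mem (by exact h), Pi.one_apply]
      rw [halfFlipped, decide_eq_true_eq] at h
      simp only
      rw [Finset.prod_fin_eq_prod_range, Finset.prod_congr rfl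
        (g := fun i => if e (s + i) ω = true then a else a⁻¹)
        (fun i hi => by simp [hg, Finset.mem_range.1 hi]), Finset.prod_ite, Finset.prod_const,
        Finset.prod_const]
      have := Finset.card_filter_add_card_filter_not (s := Finset.range m)
        (fun i => e (s + i) ω = true)
      rw [Finset.card_range] at this
      rw [inv_pow, ← div_eq_mul_inv, one_le_div (by positivity)]
      exact pow_le_pow_right₀ ha1 (by omega)
    · rw [Set.indicator_of_notMem (by exact h)]
      exact Finset.prod_nonneg fun i _ => hg0 _

theorem integrable_pow_lag {N m : ℕ} (hm : 2 * m ≤ N) (he : ∀ k, Measurable (e k)) {ρ : ℝ}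
    (hρ : 1 ≤ ρ) (j : ℕ) : Integrable (fun ω => ρ ^ lag N m (fun k => e k ω) j) μ := by
  refine Integrable.of_bound ((Measurable.of_discrete (f := fun d : ℕ => ρ ^ d)).comp
    (measurable_lag hm he j)).aestronglyMeasurable (ρ ^ (1 + 2 * j)) (ae_of_all _ fun ω => ?_)
  rw [Real.norm_of_nonneg (by positivity)]
  exact pow_le_pow_right₀ hρ (lag_le _ _ _ _)

/-- A good block multiplies `ρ ^ lag` by `ρ⁻¹` and a bad one by `ρ`, independently of the past. The
`+ 1` pays for the reflection at lag 0, and the factor in front for the new source bit. -/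
theorem integral_pow_lag_succ_le {N m : ℕ} (hm : 2 * m ≤ N) (he : ∀ k, Measurable (e k))
    (hind : iIndepFun e μ) {ρ : ℝ} (hρ : 1 ≤ ρ) {c : ℝ} {j : ℕ}
    (hc : μ.real {ω | blockError N m (fun k => e k ω) j = true} ≤ c) :
    ∫ ω, ρ ^ lag N m (fun k => e k ω) (j + 1) ∂μ ≤
      ρ ^ (j % 2) * ((ρ⁻¹ + (ρ - ρ⁻¹) * c) * ∫ ω, ρ ^ lag N m (fun k => e k ω) j ∂μ + 1) := by
  have hρ0 : 0 < ρ := by linarith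
  have hρi : ρ⁻¹ ≤ ρ := (inv_le_one_of_one_le₀ hρ).trans hρ
  set E := {ω | blockError N m (fun k => e k ω) j = true}
  have hE : MeasurableSet E := measurable_blockError he j (measurableSet_singleton true)
  have hI := integrable_pow_lag (μ := μ) hm he hρ j
  have hprod : ∫ ω, ρ ^ lag N m (fun k => e k ω) j * E.indicator 1 ω ∂μ =
      (∫ ω, ρ ^ lag N m (fun k => e k ω) j ∂μ) * μ.real E := by
    have h := (indepFun_lag_blockError hm he hind j).comp (φ := fun d : ℕ => ρ ^ d)
      (ψ := fun b : Bool => if b then (1 : ℝ) else 0) Measurable.of_discrete Measurable.of_discrete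
    have h1 := h.integral_fun_mul_eq_mul_integral
      ((Measurable.of_discrete (f := fun d : ℕ => ρ ^ d)).comp
        (measurable_lag hm he j)).aestronglyMeasurable
      ((Measurable.of_discrete (f := fun b : Bool => if b then (1 : ℝ) else 0)).comp
        (measurable_blockError he j)).aestronglyMeasurable
    have h2 : E.indicator (1 : Ω → ℝ) = (fun b : Bool => if b then (1 : ℝ) else 0) ∘
        fun ω => blockError N m (fun k => e k ω) j := by
      funext ω
      simp [Set.indicator_apply, E]
    rw [← integral_indicator_one hE, h2]
    exact h1
  have hIE : Integrable (fun ω => ρ ^ lag N m (fun k => e k ω) j * E.indicator 1 ω) μ := by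
    have : (fun ω => ρ ^ lag N m (fun k => e k ω) j * E.indicator 1 ω) =
        E.indicator fun ω => ρ ^ lag N m (fun k => e k ω) j := by
      funext ω
      by_cases h : ω ∈ E <;> simp [h]
    rw [this]
    exact hI.indicator hE
  calc ∫ ω, ρ ^ lag N m (fun k => e k ω) (j + 1) ∂μ
      ≤ ∫ ω, ρ ^ (j % 2) * (ρ⁻¹ * ρ ^ lag N m (fun k => e k ω) j +
          (ρ - ρ⁻¹) * (ρ ^ lag N m (fun k => e k ω) j * E.indicator 1 ω) + 1) ∂μ := by
        refine integral_mono (integrable_pow_lag hm he hρ _)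
          ((((hI.const_mul _).add (hIE.const_mul _)).add (integrable_const _)).const_mul _)
          fun ω => ?_
        simp only [lag]
        rw [pow_add, mul_comm]
        refine mul_le_mul_of_nonneg_left ?_ (by positivity)
        by_cases h : blockError N m (fun k => e k ω) j = true
        · rw [if_pos h, Set.indicator_of_mem (by exact h), Pi.one_apply, pow_succ]
          linarith
        · rw [if_neg h, Set.indicator_of_notMem (by exact h)]
          rcases Nat.eq_zero_or_pos (lag N m (fun k => e k ω) j) with h0 | h0
          · rw [h0]; simp; positivity
          · obtain ⟨d, hd⟩ := Nat.exists_eq_succ_of_ne_zero h0.ne'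
            rw [hd, Nat.succ_eq_add_one, Nat.add_sub_cancel, pow_succ, mul_comm (ρ ^ d),
              inv_mul_cancel_left₀ hρ0.ne']
            linarith
    _ = ρ ^ (j % 2) * ((ρ⁻¹ + (ρ - ρ⁻¹) * μ.real E) *
          ∫ ω, ρ ^ lag N m (fun k => e k ω) j ∂μ + 1) := by
        rw [integral_const_mul, integral_add ((hI.const_mul _).fun_add (hIE.const_mul _))
          (integrable_const _), integral_add (hI.const_mul _) (hIE.const_mul _),
          integral_const_mul, integral_const_mul, hprod]
        rw [integral_const, probReal_univ, one_smul]
        ring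
    _ ≤ _ := by
        have h0 : 0 ≤ ∫ ω, ρ ^ lag N m (fun k => e k ω) j ∂μ :=
          integral_nonneg fun ω => by positivity
        have h1 : 0 ≤ ρ - ρ⁻¹ := by linarith
        gcongr

/-- Over two blocks the mean is multiplied by `(z * g) ^ 2`, up to additive constants, where `z ^ 2`
comes from the single source bit; so `z * g < 1` is what is needed. -/
theorem exists_integral_pow_lag_le {N m : ℕ} (hm : 2 * m ≤ N) (he : ∀ k, Measurable (e k))
    (hind : iIndepFun e μ) {z : ℝ} (hz : 1 < z) {c : ℝ}
    (hc : ∀ j, μ.real {ω | blockError N m (fun k => e k ω) j = true} ≤ c)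
    (hcz : c * ((1 + z) * (1 + z ^ 2)) < 1) :
    ∃ C, ∀ j, ∫ ω, (z ^ 2) ^ lag N m (fun k => e k ω) j ∂μ ≤ C := by
  have hz0 : 0 < z := by linarith
  have hρ : 1 ≤ z ^ 2 := by nlinarith
  have hρi : (z ^ 2)⁻¹ ≤ z ^ 2 := (inv_le_one_of_one_le₀ hρ).trans hρ
  have hc0 : 0 ≤ c := measureReal_nonneg.trans (hc 0)
  set g := (z ^ 2)⁻¹ + (z ^ 2 - (z ^ 2)⁻¹) * c with hg
  have hg0 : 0 ≤ g := by
    have : 0 ≤ z ^ 2 - (z ^ 2)⁻¹ := by linarith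
    positivity
  have hθ : z * g < 1 := by
    -- This rests on `z ^ 4 - 1 = (z - 1) * (1 + z) * (1 + z ^ 2)` and explains the form of `hcz`.
    have : z * g = (1 + (z - 1) * (c * ((1 + z) * (1 + z ^ 2)))) / z := by
      rw [hg]; field_simp; ring
    rw [this, div_lt_one hz0]
    nlinarith
  set C := z ^ 2 / (1 - z * g) with hC
  have hCg : z * g * C + z ^ 2 = C := by
    have : 1 - z * g ≠ 0 := by linarith
    rw [hC]; field_simp; ring
  have hC0 : 0 ≤ C := div_nonneg (by positivity) (by linarith)
  set a := fun j => ∫ ω, (z ^ 2) ^ lag N m (fun k => e k ω) j ∂μ with ha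
  have ha0 : ∀ j, 0 ≤ a j := fun j => integral_nonneg fun ω => by positivity
  have hstep : ∀ j, a (j + 1) ≤ (z ^ 2) ^ (j % 2) * (g * a j + 1) := fun j =>
    integral_pow_lag_succ_le hm he hind hρ (hc j)
  -- The weight spreads the factor `z ^ 2`, paid every second block, evenly over both blocks, so one
  -- fixed point `C` serves both parities.
  have key : ∀ j, a j * z ^ (j % 2) ≤ C := by
    intro j
    induction j with
    | zero =>
      have : a 0 = z ^ 2 := by simp [ha, lag]
      rw [this]
      have : 0 ≤ z * g * C := by positivity
      simpa using (by linarith : z ^ 2 ≤ C)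
    | succ j ih =>
      have h1 := hstep j
      rcases Nat.mod_two_eq_zero_or_one j with h | h
      · rw [h] at h1 ih
        rw [show (j + 1) % 2 = 1 by omega, pow_one]
        rw [pow_zero, mul_one] at ih
        rw [pow_zero, one_mul] at h1
        have h2 : a (j + 1) * z ≤ (g * a j + 1) * z := mul_le_mul_of_nonneg_right h1 hz0.le
        have h3 : z * g * a j ≤ z * g * C := mul_le_mul_of_nonneg_left ih (by positivity)
        nlinarith
      · rw [h] at h1 ih
        rw [show (j + 1) % 2 = 0 by omega, pow_zero, mul_one]
        rw [pow_one] at ih h1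
        have h3 : z * g * (a j * z) ≤ z * g * C := mul_le_mul_of_nonneg_left ih (by positivity)
        nlinarith
  refine ⟨C, fun j => le_trans ?_ (key j)⟩
  exact le_mul_of_one_le_right (ha0 j) (one_le_pow₀ hz.le)

end Noise

/-! ### The source -/

theorem walk_congr {N m : ℕ} (hm : 2 * m ≤ N) {b b' e e' : ℕ → Bool} {j : ℕ}
    (hb : ∀ k < j, b k = b' k) (he : ∀ k < N * j, e k = e' k) :
    walk N m b e j = walk N m b' e' j := by
  induction j with
  | zero => rfl
  | succ j ih =>
    rw [Nat.mul_succ] at he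
    rw [walk, walk, ih (fun k hk => hb k (by omega)) (fun k hk => he k (by omega)),
      bitList_congr (b := b) (b' := b') fun k hk => hb k (by omega)]
    congr 2
    · exact majority_congr fun i hi => by rw [he (N * j + i) (by omega)]
    · exact majority_congr fun i hi => by rw [he (N * j + m + i) (by omega)]

/-- The state of the plant without control. -/
def sourceState (α z0 : ℝ) (w : ℕ → ℝ) : ℕ → ℝ
  | 0 => z0
  | t + 1 => α * sourceState α z0 w t + w t

/-- The center of the cell of the source after `i` bits, one every `r` steps. -/
noncomputable def sourceCenter (α L : ℝ) (r : ℕ) (X : ℕ → ℝ) : ℕ → ℝ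
  | 0 => 0
  | i + 1 => sourceCenter α L r X i +
      (if sourceCenter α L r X i ≤ X (r * i) / α ^ (r * i) then 1 else -1) *
        (L / 2 / (α ^ r) ^ i)

open Classical in
/-- The `i`-th bit of the source. -/
noncomputable def sourceBit (α L : ℝ) (r : ℕ) (X : ℕ → ℝ) (i : ℕ) : Bool :=
  decide (sourceCenter α L r X i ≤ X (r * i) / α ^ (r * i))

theorem center_bitList_sourceBit (α L : ℝ) (r : ℕ) (X : ℕ → ℝ) (i : ℕ) :
    center (α ^ r) L (bitList (sourceBit α L r X) i) = sourceCenter α L r X i := by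
  induction i with
  | zero => rfl
  | succ i ih => simp [bitList, center, ih, length_bitList, sourceCenter, sourceBit]

theorem sourceCenter_congr (α L : ℝ) {r : ℕ} {X X' : ℕ → ℝ} {i : ℕ}
    (h : ∀ t < r * i, X t = X' t) (hr : 0 < r) :
    sourceCenter α L r X i = sourceCenter α L r X' i := by
  induction i with
  | zero => rfl
  | succ i ih =>
    rw [Nat.mul_succ] at h
    rw [sourceCenter, sourceCenter, ih fun t ht => h t (by omega), h (r * i) (by omega)]

theorem sourceBit_congr (α L : ℝ) {r : ℕ} {X X' : ℕ → ℝ} {i : ℕ}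
    (h : ∀ t ≤ r * i, X t = X' t) (hr : 0 < r) :
    sourceBit α L r X i = sourceBit α L r X' i := by
  rw [sourceBit, sourceBit, sourceCenter_congr α L (fun t ht => h t ht.le) hr, h _ le_rfl]

theorem measurable_sourceCenter {B : Type*} [MeasurableSpace B] (α L : ℝ) (r : ℕ) {X : B → ℕ → ℝ}
    (hX : ∀ t, Measurable fun x => X x t) (i : ℕ) :
    Measurable fun x => sourceCenter α L r (X x) i := by
  induction i with
  | zero => exact measurable_const
  | succ i ih =>
    simp only [sourceCenter]
    exact ih.add ((Measurable.ite (measurableSet_le ih ((hX _).div_const _)) measurable_const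
      measurable_const).mul_const _)

theorem measurable_sourceBit {B : Type*} [MeasurableSpace B] (α L : ℝ) (r : ℕ) {X : B → ℕ → ℝ}
    (hX : ∀ t, Measurable fun x => X x t) (i : ℕ) :
    Measurable fun x => sourceBit α L r (X x) i := by
  refine measurable_to_bool ?_
  have : (fun x => sourceBit α L r (X x) i) ⁻¹' {true} =
      {x | sourceCenter α L r (X x) i ≤ X x (r * i) / α ^ (r * i)} := by
    ext x; simp [sourceBit]
  rw [this]
  exact measurableSet_le (measurable_sourceCenter α L r hX i) ((hX _).div_const _)

theorem abs_sourceState_div_sub_le {α z0 M : ℝ} {w : ℕ → ℝ} (hα : 1 < α)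
    (hw : ∀ t, |w t| ≤ M) (s k : ℕ) :
    |sourceState α z0 w (s + k) / α ^ (s + k) - sourceState α z0 w s / α ^ s| ≤
      k * (M / α ^ s) := by
  have hα0 : 0 < α := by linarith
  have hM : 0 ≤ M := (abs_nonneg _).trans (hw 0)
  induction k with
  | zero => simp
  | succ k ih =>
    have h1 : sourceState α z0 w (s + (k + 1)) / α ^ (s + (k + 1)) - sourceState α z0 w s / α ^ s =
        (sourceState α z0 w (s + k) / α ^ (s + k) - sourceState α z0 w s / α ^ s) +
          w (s + k) / α ^ (s + (k + 1)) := by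
      rw [← add_assoc s k 1, sourceState, pow_succ]
      field_simp
      ring
    have h2 : |w (s + k) / α ^ (s + (k + 1))| ≤ M / α ^ s := by
      rw [abs_div, abs_of_pos (pow_pos hα0 _)]
      exact div_le_div₀ hM (hw _) (by positivity) (pow_le_pow_right₀ hα.le (by omega))
    rw [h1]
    push_cast
    linarith [abs_add_le (sourceState α z0 w (s + k) / α ^ (s + k) - sourceState α z0 w s / α ^ s)
      (w (s + k) / α ^ (s + (k + 1)))]

/-- A bit halves the cell radius, and `r` steps of disturbance add at most `r * M` on the scale of
the cell; `hL` says that the sum fits into the next radius. Allowing `k = r` lets the bound feed its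
own induction. -/
theorem abs_sourceState_div_sub_sourceCenter_le {α z0 M L : ℝ} {w : ℕ → ℝ} {r : ℕ} (hα : 1 < α)
    (hw : ∀ t, |w t| ≤ M) (hz : |z0| ≤ L) (hL : L / 2 + r * M ≤ L / α ^ r) (i k : ℕ)
    (hk : k ≤ r) :
    |sourceState α z0 w (r * i + k) / α ^ (r * i + k) -
      sourceCenter α L r (sourceState α z0 w) (i + 1)| ≤ L / (α ^ r) ^ (i + 1) := by
  have hα0 : 0 < α := by linarith
  have hM : 0 ≤ M := (abs_nonneg _).trans (hw 0)
  set X := sourceState α z0 w with hX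
  have step : ∀ i, |X (r * i) / α ^ (r * i) - sourceCenter α L r X i| ≤ L / (α ^ r) ^ i →
      ∀ k ≤ r, |X (r * i + k) / α ^ (r * i + k) - sourceCenter α L r X (i + 1)| ≤
        L / (α ^ r) ^ (i + 1) := by
    intro i h k hk
    have h1 := abs_sourceState_div_sub_le (z0 := z0) hα hw (r * i) k
    rw [← hX] at h1
    have h2 : |X (r * i) / α ^ (r * i) - sourceCenter α L r X (i + 1)| ≤ L / 2 / (α ^ r) ^ i := by
      have h3 : L / (α ^ r) ^ i = 2 * (L / 2 / (α ^ r) ^ i) := by ring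
      rw [sourceCenter]
      rw [abs_le] at h ⊢
      split_ifs with hc <;> constructor <;> linarith
    have h4 : k * (M / α ^ (r * i)) ≤ r * M / (α ^ r) ^ i := by
      rw [pow_mul, mul_div_assoc]
      have : (k : ℝ) ≤ r := by exact_mod_cast hk
      gcongr
    have h5 : L / (α ^ r) ^ (i + 1) = L / α ^ r / (α ^ r) ^ i := by
      rw [pow_succ', div_div]
    calc _ ≤ |X (r * i + k) / α ^ (r * i + k) - X (r * i) / α ^ (r * i)| +
          |X (r * i) / α ^ (r * i) - sourceCenter α L r X (i + 1)| := abs_sub_le _ _ _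
      _ ≤ r * M / (α ^ r) ^ i + L / 2 / (α ^ r) ^ i := add_le_add (h1.trans h4) h2
      _ = (L / 2 + r * M) / (α ^ r) ^ i := by ring
      _ ≤ L / α ^ r / (α ^ r) ^ i := by gcongr
      _ = _ := h5.symm
  have main : ∀ i, |X (r * i) / α ^ (r * i) - sourceCenter α L r X i| ≤ L / (α ^ r) ^ i := by
    intro i
    induction i with
    | zero => simpa [sourceCenter, hX, sourceState] using hz
    | succ i ih => exact step i ih r le_rfl
  exact step i (main i) k hk

/-! ### The scheme -/

section Scheme

variable (α L : ℝ) (n K m : ℕ)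

/-- The estimate of the uncontrolled state at time `t` from the channel outputs: blocks consist of
the `n * K` uses during `K` plant steps, and there is one source bit every `2 * K` steps. -/
noncomputable def sourceEstimate (y : ℕ → Bool) (t : ℕ) : ℝ :=
  α ^ t * center (α ^ (2 * K)) L (decodedNode (n * K) m y (t / K))

/-- The difference between the uncontrolled and the controlled state. -/
noncomputable def controlShift (y : ℕ → Bool) : ℕ → ℝ
  | 0 => 0
  | t + 1 => α * sourceEstimate α L n K m y t

variable {n K m}

theorem sourceEstimate_congr (hm : 2 * m ≤ n * K) {y y' : ℕ → Bool} {t : ℕ}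
    (h : ∀ k < n * t, y k = y' k) :
    sourceEstimate α L n K m y t = sourceEstimate α L n K m y' t := by
  rw [sourceEstimate, sourceEstimate, decodedNode_congr hm]
  intro k hk
  refine h k (hk.trans_le ?_)
  rw [mul_assoc]
  exact Nat.mul_le_mul_left _ (Nat.mul_div_le t K)

theorem controlShift_congr (hm : 2 * m ≤ n * K) {y y' : ℕ → Bool} {t : ℕ}
    (h : ∀ k < n * t, y k = y' k) :
    controlShift α L n K m y t = controlShift α L n K m y' t := by
  cases t with
  | zero => rfl
  | succ t =>
    rw [controlShift, controlShift, sourceEstimate_congr α L hm]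
    exact fun k hk => h k (hk.trans_le (Nat.mul_le_mul_left _ (by omega)))

variable (n K m)

/-- The scheme: the sensor quantizes the uncontrolled state, the encoder guides the node of the
decoder to that of the source. -/
noncomputable def treeScheme : CodingScheme n where
  quantizer s z y :=
    sourceBit α L (2 * K) (fun t => extendSeq z t + controlShift α L n K m (extendSeq y) t)
      (s / (2 * K))
  measurable_quantizer s y := by
    refine measurable_sourceBit α L (2 * K) (fun t => ?_) _
    refine Measurable.add_const ?_ _
    unfold extendSeq
    split_ifs with h
    · exact measurable_pi_apply _
    · exact measurable_const
  encoder k s y :=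
    channelInput (n * K) m (fun i => extendSeq s (2 * K * i))
      (decodedNode (n * K) m (extendSeq y)) k
  estimator t y :=
    sourceEstimate α L n K m (extendSeq y) t - controlShift α L n K m (extendSeq y) t

variable {n K m}

/-- With bits and outputs defined from the uncontrolled state and the noise, there is no
circularity. It remains to check causality: each device reads only entries it already has, so the
default values of `extendSeq` never matter. -/
theorem isTrajectory_treeScheme (hK : 0 < K) (hm : 2 * m ≤ n * K) (z0 : ℝ) (w : ℕ → ℝ)
    (e b y : ℕ → Bool) (hb : b = sourceBit α L (2 * K) (sourceState α z0 w))
    (hy : y = channelOutput (n * K) m b e) :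
    IsTrajectory α (treeScheme α L n K m) z0 w e
      (fun t => sourceState α z0 w t - controlShift α L n K m y t)
      (fun t => sourceEstimate α L n K m y t - controlShift α L n K m y t)
      (fun t => -α * (sourceEstimate α L n K m y t - controlShift α L n K m y t))
      (fun s => b (s / (2 * K)))
      (channelInput (n * K) m b (walk (n * K) m b e)) y where
  init := by simp [sourceState, controlShift]
  plant t := by simp only [sourceState, controlShift]; ring
  control t := rfl
  estimate t := by
    have h : ∀ k < n * t, extendSeq (firstTerms (n * t) y) k = y k :=
      fun k hk => extendSeq_firstTerms y hk
    simp only [treeScheme]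
    rw [sourceEstimate_congr α L hm h, controlShift_congr α L hm h]
  bit i := by
    simp only [treeScheme]
    rw [hb]
    refine sourceBit_congr α L (fun t ht => ?_) (by omega)
    have ht' : t ≤ i := ht.trans (Nat.mul_div_le i _)
    rw [extendSeq_firstTerms _ (by omega), controlShift_congr α L hm
      (y := extendSeq (firstTerms (n * i) y)) (y' := y)]
    · ring
    · exact fun k hk => extendSeq_firstTerms y (hk.trans_le (Nat.mul_le_mul_left _ ht'))
  input k := by
    have hkN : n * K * (k / (n * K)) ≤ k := Nat.mul_div_le k _
    have h1 : decodedNode (n * K) m (extendSeq (firstTerms k y)) (k / (n * K)) =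
        walk (n * K) m b e (k / (n * K)) := by
      rw [← decodedNode_channelOutput hm b e, ← hy]
      exact decodedNode_congr hm fun i hi => extendSeq_firstTerms y (by omega)
    -- The sensor repeats each source bit for `2 * K` steps; the encoder reads its first copy, which
    -- is available by the current block.
    have h2 : bitList (fun i => extendSeq (firstTerms (k / n + 1) fun s => b (s / (2 * K)))
        (2 * K * i)) (k / (n * K) / 2 + 1) = bitList b (k / (n * K) / 2 + 1) := by
      refine bitList_congr fun i hi => ?_
      rw [extendSeq_firstTerms, Nat.mul_div_cancel_left _ (by omega)]
      have h3 : K * (k / (n * K)) ≤ k / n := by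
        rw [← Nat.div_div_eq_div_mul]
        exact Nat.mul_div_le _ _
      have h4 : K * (2 * i) ≤ K * (k / (n * K)) := Nat.mul_le_mul_left _ (by omega)
      have h5 : 2 * K * i = K * (2 * i) := by ring
      omega
    simp only [treeScheme, channelInput]
    rw [h1, h2]
  channel k := by rw [hy]; rfl

variable {α L}

/-- The normalized error is the cell radius plus the cost of the lag, both relative to `A ^ (i +
1)`. The growth `α ^ t ≤ A ^ (i + 1)` cancels this scale, leaving only the lag. -/
theorem abs_sourceState_sub_sourceEstimate_le {z0 M : ℝ} {w : ℕ → ℝ} (hK : 0 < K)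
    (hm : 2 * m ≤ n * K) (hα : 1 < α) (hw : ∀ t, |w t| ≤ M) (hz : |z0| ≤ L)
    (hL : L / 2 + (2 * K : ℕ) * M ≤ L / α ^ (2 * K)) (e : ℕ → Bool) (t : ℕ) :
    |sourceState α z0 w t - sourceEstimate α L n K m (channelOutput (n * K) m
      (sourceBit α L (2 * K) (sourceState α z0 w)) e) t| ≤
      (L + L * (α ^ (2 * K) / (α ^ (2 * K) - 1))) * (α ^ (2 * K)) ^ lag (n * K) m e (t / K) := by
  have hα0 : 0 < α := by linarith
  have hL0 : 0 ≤ L := (abs_nonneg _).trans hz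
  have hA : 1 < α ^ (2 * K) := one_lt_pow₀ hα (by omega)
  set A := α ^ (2 * K) with hAdef
  set X := sourceState α z0 w with hX
  set b := sourceBit α L (2 * K) X with hb
  set d := lag (n * K) m e (t / K) with hd
  set i := t / K / 2 with hi
  have hti : 2 * K * i ≤ t ∧ t < 2 * K * (i + 1) := by
    rw [hi, Nat.div_div_eq_div_mul, mul_comm K 2]
    exact ⟨Nat.mul_div_le _ _, Nat.lt_mul_div_succ t (by omega)⟩
  have h1 := abs_sourceState_div_sub_sourceCenter_le hα hw hz hL i (t - 2 * K * i)
    (by rw [Nat.mul_succ] at hti; omega)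
  rw [Nat.add_sub_cancel' hti.1, ← center_bitList_sourceBit, ← hX, ← hb, ← hAdef] at h1
  have h2 := (treeNear_walk (n * K) m b e (t / K)).abs_center_sub_le hA hL0
  rw [← hi, length_bitList, ← hd] at h2
  set c := center A L (walk (n * K) m b e (t / K)) with hc
  have h3 : |X t / α ^ t - c| ≤ L / A ^ (i + 1) + L * (A / (A - 1)) * (A ^ d / A ^ (i + 1)) := by
    refine (abs_sub_le _ _ _).trans (add_le_add h1 ?_)
    rw [abs_sub_comm]
    exact h2
  have hA0 : 0 < A := by linarith
  have hA1 : 0 < A - 1 := by linarith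
  have hd1 : 1 ≤ A ^ d := one_le_pow₀ hA.le
  rw [sourceEstimate, decodedNode_channelOutput hm, ← hc]
  have h4 : X t - α ^ t * c = α ^ t * (X t / α ^ t - c) := by field_simp
  have h5 : α ^ t ≤ A ^ (i + 1) := by
    rw [hAdef, ← pow_mul]
    exact pow_le_pow_right₀ hα.le hti.2.le
  rw [h4, abs_mul, abs_of_pos (pow_pos hα0 t)]
  calc α ^ t * |X t / α ^ t - c|
      ≤ A ^ (i + 1) * (L / A ^ (i + 1) + L * (A / (A - 1)) * (A ^ d / A ^ (i + 1))) := by gcongr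
    _ = L + L * (A / (A - 1)) * A ^ d := by field_simp
    _ ≤ _ := by nlinarith

end Scheme

/-! ### Stabilization -/

section Stabilization

variable {Ω : Type*} [MeasurableSpace Ω] {μ : Measure Ω} [IsProbabilityMeasure μ]

theorem measurable_sourceState {α : ℝ} {Z0 : Ω → ℝ} {W : ℕ → Ω → ℝ} (hZ0 : Measurable Z0)
    (hW : ∀ t, Measurable (W t)) (t : ℕ) :
    Measurable fun ω => sourceState α (Z0 ω) (fun t => W t ω) t := by
  induction t with
  | zero => exact hZ0
  | succ t ih => exact (ih.const_mul _).add (hW t)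

theorem measurable_sourceEstimate_channelOutput {α L : ℝ} {n K m : ℕ} (hm : 2 * m ≤ n * K)
    {b e : ℕ → Ω → Bool} (hb : ∀ k, Measurable (b k)) (he : ∀ k, Measurable (e k)) (t : ℕ) :
    Measurable fun ω => sourceEstimate α L n K m
      (channelOutput (n * K) m (fun k => b k ω) fun k => e k ω) t := by
  refine measurable_of_firstTerms (a := fun k ω => (b k ω, e k ω))
    (fun k => (hb k).prodMk (he k))
    (F := fun x => sourceEstimate α L n K m
      (channelOutput (n * K) m (fun k => (x k).1) fun k => (x k).2) t)
    (M := t / K + n * K * (t / K)) fun x x' h => ?_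
  simp only [sourceEstimate]
  rw [decodedNode_channelOutput hm, decodedNode_channelOutput hm,
    walk_congr hm (fun k hk => by rw [h k (hk.trans_le (Nat.le_add_right _ _))])
      (fun k hk => by rw [h k (hk.trans_le (Nat.le_add_left _ _))])]

theorem boundedMoment_of_abs_le_pow_lag {N m : ℕ} (hm : 2 * m ≤ N) {e : ℕ → Ω → Bool}
    (he : ∀ k, Measurable (e k)) {A η C M : ℝ} (hA : 1 ≤ A) (hη : 0 ≤ η) (hC : 0 ≤ C)
    (hM : ∀ j, ∫ ω, (A ^ η) ^ lag N m (fun k => e k ω) j ∂μ ≤ M) {V : ℕ → Ω → ℝ}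
    (hV : ∀ t, Measurable (V t)) (f : ℕ → ℕ)
    (hbound : ∀ t, ∀ᵐ ω ∂μ, |V t ω| ≤ C * A ^ lag N m (fun k => e k ω) (f t)) :
    BoundedMoment μ η V := by
  have hA0 : 0 ≤ A := by linarith
  refine ⟨C ^ η * M, fun t => ?_⟩
  have hint := (integrable_pow_lag (μ := μ) hm he (Real.one_le_rpow hA hη) (f t)).const_mul (C ^ η)
  have hle : ∀ᵐ ω ∂μ, |V t ω| ^ η ≤ C ^ η * (A ^ η) ^ lag N m (fun k => e k ω) (f t) := by
    filter_upwards [hbound t] with ω h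
    have := Real.rpow_le_rpow (abs_nonneg _) h hη
    rwa [Real.mul_rpow hC (by positivity), ← Real.rpow_natCast_mul hA0, mul_comm _ η,
      Real.rpow_mul_natCast hA0] at this
  have hI : Integrable (fun ω => |V t ω| ^ η) μ := by
    refine hint.mono' (((hV t).abs).pow_const η).aestronglyMeasurable ?_
    filter_upwards [hle] with ω h
    rwa [Real.norm_of_nonneg (by positivity)]
  refine ⟨hI, (integral_mono_ae hI hint hle).trans ?_⟩
  rw [integral_const_mul]
  exact mul_le_mul_of_nonneg_left (hM _) (by positivity)

theorem isStabilizable_of_flip_bound {p : ℝ} {n K m : ℕ} (hK : 0 < K) (hm : 2 * m ≤ n * K)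
    {α Δ Wmax η P : ℝ} (hα : 1 < α) (hα2 : α ^ (2 * K) < 2) (hη : 1 ≤ η)
    {Z0 : Ω → ℝ} (hZ0 : Measurable Z0) (hZ0_bdd : ∀ᵐ ω ∂μ, Z0 ω ∈ Set.Icc (-Δ) Δ)
    {W : ℕ → Ω → ℝ} (hW : ∀ t, Measurable (W t))
    (hW_bdd : ∀ t, ∀ᵐ ω ∂μ, W t ω ∈ Set.Icc (-Wmax) Wmax)
    {e : ℕ → Ω → Bool} (he : IsBSCNoise μ p e)
    (hP : ∀ s, μ.real {ω | halfFlipped m (fun i => e (s + i) ω) = true} ≤ P)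
    (hsmall : 2 * P * ((1 + α ^ (K * η)) * (1 + (α ^ (K * η)) ^ 2)) < 1) :
    IsStabilizable μ n α η Z0 W e := by
  have hα0 : 0 < α := by linarith
  have hA : 1 < α ^ (2 * K) := one_lt_pow₀ hα (by omega)
  set A := α ^ (2 * K) with hAdef
  have hgap : 0 < 1 / A - 1 / 2 := by
    rw [sub_pos]; exact one_div_lt_one_div_of_lt (by linarith) hα2
  set M := |Wmax| with hMdef
  -- Large enough to contain the initial state and to absorb the disturbances in the gap between `L
  -- / 2` and `L / A`.
  set L := |Δ| + (2 * K : ℕ) * M / (1 / A - 1 / 2) with hLdef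
  have hM0 : 0 ≤ M := abs_nonneg _
  have hL0 : 0 ≤ L := by positivity
  have hL : L / 2 + (2 * K : ℕ) * M ≤ L / A := by
    have h1 : (2 * K : ℕ) * M ≤ L * (1 / A - 1 / 2) := by
      rw [hLdef, add_mul, div_mul_cancel₀ _ hgap.ne']
      have := mul_nonneg (abs_nonneg Δ) hgap.le
      linarith
    have h2 : L * (1 / A - 1 / 2) = L / A - L / 2 := by ring
    linarith
  have hae : ∀ᵐ ω ∂μ, |Z0 ω| ≤ L ∧ ∀ t, |W t ω| ≤ M := by
    filter_upwards [hZ0_bdd, ae_all_iff.2 hW_bdd] with ω h1 h2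
    refine ⟨?_, fun t => ?_⟩
    · have h3 : 0 ≤ (2 * K : ℕ) * M / (1 / A - 1 / 2) := by positivity
      exact (abs_le.2 h1).trans ((le_abs_self Δ).trans (by linarith))
    · exact (abs_le.2 (h2 t)).trans (le_abs_self _)
  have hblock : ∀ j, μ.real {ω | blockError (n * K) m (fun k => e k ω) j = true} ≤ 2 * P := by
    intro j
    have : {ω | blockError (n * K) m (fun k => e k ω) j = true} =
        {ω | halfFlipped m (fun i => e (n * K * j + i) ω) = true} ∪
          {ω | halfFlipped m (fun i => e (n * K * j + m + i) ω) = true} := by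
      ext ω; simp [blockError]
    rw [this]
    refine (measureReal_union_le _ _).trans ?_
    linarith [hP (n * K * j), hP (n * K * j + m)]
  have hz : 1 < α ^ (K * η) := Real.one_lt_rpow hα (by positivity)
  have hAη : (α ^ (K * η)) ^ 2 = A ^ η := by
    rw [hAdef, ← Real.rpow_natCast, ← Real.rpow_natCast, ← Real.rpow_mul hα0.le,
      ← Real.rpow_mul hα0.le]
    congr 1
    push_cast
    ring
  obtain ⟨C, hC⟩ := exists_integral_pow_lag_le hm he.measurable he.indep hz hblock hsmall
  rw [hAη] at hC
  set b : ℕ → Ω → Bool := fun k ω =>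
    sourceBit α L (2 * K) (sourceState α (Z0 ω) fun t => W t ω) k with hbdef
  have hX := measurable_sourceState (α := α) hZ0 hW
  have hb : ∀ k, Measurable (b k) := fun k => measurable_sourceBit α L (2 * K) hX k
  set y : Ω → ℕ → Bool := fun ω =>
    channelOutput (n * K) m (fun k => b k ω) fun k => e k ω with hydef
  have hest : ∀ t, Measurable fun ω => sourceEstimate α L n K m (y ω) t :=
    fun t => measurable_sourceEstimate_channelOutput hm hb he.measurable t
  set C₁ := L + L * (A / (A - 1)) with hC₁
  have hC₁0 : 0 ≤ C₁ := by
    have : 0 < A - 1 := by linarith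
    positivity
  have herr : ∀ᵐ ω ∂μ, ∀ t, |sourceState α (Z0 ω) (fun t => W t ω) t -
      sourceEstimate α L n K m (y ω) t| ≤
        C₁ * A ^ lag (n * K) m (fun k => e k ω) (t / K) := by
    filter_upwards [hae] with ω h t
    exact abs_sourceState_sub_sourceEstimate_le hK hm hα h.2 h.1 hL _ t
  refine ⟨treeScheme α L n K m, _, _, _, _, _, _,
    fun ω => isTrajectory_treeScheme α L hK hm (Z0 ω) (fun t => W t ω) (fun k => e k ω)
      (fun k => b k ω) (y ω) rfl rfl, ?_, ?_⟩
  · refine boundedMoment_of_abs_le_pow_lag (M := C) hm he.measurable hA.le (by linarith) hC₁0 hC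
      (fun t => ?_) (fun t => t / K) fun t => ?_
    · simp only [sub_sub_sub_cancel_right]
      exact (hX t).sub (hest t)
    · filter_upwards [herr] with ω h
      simpa only [sub_sub_sub_cancel_right] using h t
  -- After one step the state is `α` times the previous estimation error plus the disturbance, hence
  -- the lag at `t - 1`; at time 0 the summand `L` covers the initial state.
  · refine boundedMoment_of_abs_le_pow_lag (M := C) (C := L + α * C₁ + M) hm he.measurable hA.le
      (by linarith) (by positivity) hC (fun t => ?_) (fun t => (t - 1) / K) fun t => ?_
    · refine (hX t).sub ?_
      cases t with
      | zero => exact measurable_const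
      | succ t => exact (hest t).const_mul α
    · filter_upwards [herr, hae] with ω h h'
      have hpow : 1 ≤ A ^ lag (n * K) m (fun k => e k ω) ((t - 1) / K) := one_le_pow₀ hA.le
      cases t with
      | zero =>
        simp only [sourceState, controlShift, sub_zero]
        have : 0 ≤ α * C₁ + M := by positivity
        nlinarith [h'.1]
      | succ t =>
        rw [Nat.add_sub_cancel] at hpow ⊢
        have h1 : sourceState α (Z0 ω) (fun t => W t ω) (t + 1) -
            controlShift α L n K m (y ω) (t + 1) =
            α * (sourceState α (Z0 ω) (fun t => W t ω) t - sourceEstimate α L n K m (y ω) t) +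
              W t ω := by
          rw [sourceState, controlShift]; ring
        have h2 := mul_le_mul_of_nonneg_left (h t) hα0.le
        rw [h1]
        refine (abs_add_le _ _).trans ?_
        rw [abs_mul, abs_of_pos hα0]
        have h3 := h'.2 t
        nlinarith

end Stabilization

/-! ### Choice of block length and repetition count -/

theorem small_error_of_le {π β z : ℝ} (hz : 1 < z) {c : ℝ} (hzc : z ≤ 2 ^ c)
    (hβ : 0 ≤ β) (hπ : π ≤ 2 ^ (-(3 * c) - 2 - β)) :
    π * ((1 + z) * (1 + z ^ 2)) < 1 := by
  have h1 : (1 + z) * (1 + z ^ 2) < 4 * z ^ 3 := by nlinarith [mul_pos (sub_pos.2 hz) (sub_pos.2 hz)]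
  have h2 : z ^ 3 ≤ 2 ^ (3 * c) := by
    calc z ^ 3 ≤ ((2 : ℝ) ^ c) ^ 3 := by gcongr
      _ = 2 ^ (3 * c) := by rw [← Real.rpow_natCast, ← Real.rpow_mul (by norm_num)]; ring_nf
  have h3 : (4 : ℝ) * 2 ^ (3 * c) = 2 ^ (3 * c + 2) := by
    rw [Real.rpow_add (by norm_num)]; norm_num; ring
  calc π * ((1 + z) * (1 + z ^ 2))
      ≤ 2 ^ (-(3 * c) - 2 - β) * ((1 + z) * (1 + z ^ 2)) := by gcongr
    _ < 2 ^ (-(3 * c) - 2 - β) * 2 ^ (3 * c + 2) := by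
        refine mul_lt_mul_of_pos_left ?_ (by positivity)
        rw [← h3]
        linarith
    _ = 2 ^ (-β) := by rw [← Real.rpow_add (by norm_num)]; ring_nf
    _ ≤ 1 := Real.rpow_le_one_of_one_le_of_nonpos (by norm_num) (by linarith)

/-- The code corrects block errors according to the noise only, uniformly over all bounded
disturbances: independence of the plant and the channel is not needed. For `n ≤ 4` an instruction
takes two channel uses in one plant step, for `n ≥ 5` it takes `2 * n` uses in two steps. -/
theorem corollary1 {Ω : Type*} [MeasurableSpace Ω] (μ : Measure Ω) [IsProbabilityMeasure μ]
    (p : ℝ) (hp0 : 0 < p) (hp : p < 1 / 2) (n : ℕ) (hn : 1 ≤ n)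
    (α : ℝ) (hα : 1 < α)
    (Δ : ℝ) (Z0 : Ω → ℝ) (hZ0 : Measurable Z0) (hZ0_bdd : ∀ᵐ ω ∂μ, Z0 ω ∈ Set.Icc (-Δ) Δ)
    (Wmax : ℝ) (W : ℕ → Ω → ℝ) (hW : ∀ t, Measurable (W t))
    (hW_bdd : ∀ t, ∀ᵐ ω ∂μ, W t ω ∈ Set.Icc (-Wmax) Wmax)
    (hW_indep : iIndepFun W μ) (hW_ident : ∀ t, IdentDistrib (W t) (W 0) μ μ)
    (e : ℕ → Ω → Bool) (he : IsBSCNoise μ p e)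
    (he_indep : IndepFun (fun ω => (Z0 ω, fun t => W t ω)) (fun ω k => e k ω) μ)
    (β : ℝ) (hβ : IsErrorExponent p n β)
    (η : ℝ) (hη : 1 ≤ η)
    (hlog : Real.logb 2 α ≤ min (1 / (n : ℝ)) (β / η)) :
    IsStabilizable μ n α η Z0 W e := by
  have hq0 : 0 < 1 - p := by linarith
  have hn0 : (0 : ℝ) < n := by exact_mod_cast hn
  have hα0 : 0 < α := by linarith
  have hlogα : 0 < Real.logb 2 α := Real.logb_pos (by norm_num) hα
  obtain ⟨hα1, hα2⟩ := le_min_iff.1 hlog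
  have hβη : η * Real.logb 2 α ≤ β := by rwa [le_div_iff₀ (by linarith), mul_comm] at hα2
  have hαβ : Real.logb 2 α ≤ β := by nlinarith
  have hβ0 : 0 < β := by linarith
  have h4 : 0 < 4 * p * (1 - p) := by positivity
  have hcut := hβ.add_le hβ0.le fun l hl => psi_le_neg_logb hp0 hp hl
  have hrate := hβ.add_le hβ0.le fun l hl => psi_le_one_sub_logb hp0 hp hl
  have hpos : 0 < Real.logb 2 (1 + 2 * p) := Real.logb_pos (by norm_num) (by linarith)
  -- For `n = 1`, `hrate` would force `β < 0`. The same strict bound gives `α ^ 2 < 2` when `n = 2`,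
  -- where the rate condition alone would allow equality.
  have hn2 : 2 ≤ n := by
    by_contra h
    have h1 : n = 1 := by omega
    rw [h1] at hrate
    norm_num at hrate
    linarith
  have hpq : 4 * p * (1 - p) ≤ 2 ^ (-8 * (β + 1 / n)) := by
    rw [← Real.logb_le_iff_le_rpow (by norm_num) h4]
    linarith
  have hαpow : ∀ x : ℝ, α ^ x = 2 ^ (Real.logb 2 α * x) := by
    intro x
    rw [Real.rpow_mul (by norm_num), Real.rpow_logb (by norm_num) (by norm_num) hα0]
  rcases le_or_gt n 4 with hn4 | hn5
  · have hn4' : (n : ℝ) ≤ 4 := by exact_mod_cast hn4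
    refine isStabilizable_of_flip_bound (K := 1) (m := 1) (P := p) one_pos (by omega) hα ?_ hη hZ0
      hZ0_bdd hW hW_bdd he (fun s => ?_) ?_
    · rw [← Real.rpow_natCast, hαpow]
      have : Real.logb 2 α < 1 / 2 := by
        rcases hn2.eq_or_lt with h | h
        · rw [← h] at hrate
          norm_num at hrate
          linarith
        · have h3 : (3 : ℝ) ≤ n := by exact_mod_cast h
          have : 1 / (n : ℝ) ≤ 1 / 3 := one_div_le_one_div_of_le (by norm_num) h3
          linarith
      calc (2 : ℝ) ^ (Real.logb 2 α * ((2 * 1 : ℕ) : ℝ)) < 2 ^ (1 : ℝ) :=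
            Real.rpow_lt_rpow_of_exponent_lt (by norm_num) (by push_cast; linarith)
        _ = 2 := Real.rpow_one 2
    · rw [← he.real_flip hp0.le s]
      refine le_of_eq (congrArg _ ?_)
      ext ω
      cases h : e s ω <;> simp [halfFlipped, Finset.filter_singleton, h]
    · refine small_error_of_le (c := β) (Real.one_lt_rpow hα (by positivity)) ?_ hβ0.le ?_
      · rw [hαpow]
        refine Real.rpow_le_rpow_of_exponent_le (by norm_num) ?_
        push_cast
        linarith
      -- Without repetition the block error is at most `2 * p`; here `8 / n ≥ 2` supplies the
      -- constant 2 in the required exponent.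
      · have h1 : 2 * p ≤ 4 * p * (1 - p) := by nlinarith
        refine (h1.trans hpq).trans (Real.rpow_le_rpow_of_exponent_le (by norm_num) ?_)
        have : 1 / 4 ≤ 1 / (n : ℝ) := one_div_le_one_div_of_le hn0 hn4'
        linarith
  · have hn5' : (5 : ℝ) ≤ n := by exact_mod_cast hn5
    refine isStabilizable_of_flip_bound (K := 2) (m := n) (P := √(4 * p * (1 - p)) ^ n) two_pos
      (by omega) hα ?_ hη hZ0 hZ0_bdd hW hW_bdd he (he.real_halfFlipped_le hp0 hp n) ?_
    · rw [← Real.rpow_natCast, hαpow]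
      have : 1 / (n : ℝ) ≤ 1 / 5 := one_div_le_one_div_of_le (by norm_num) hn5'
      calc (2 : ℝ) ^ (Real.logb 2 α * ((2 * 2 : ℕ) : ℝ)) < 2 ^ (1 : ℝ) :=
            Real.rpow_lt_rpow_of_exponent_lt (by norm_num) (by push_cast; linarith)
        _ = 2 := Real.rpow_one 2
    · refine small_error_of_le (c := 2 * β) (Real.one_lt_rpow hα (by positivity)) ?_ hβ0.le ?_
      · rw [hαpow]
        refine Real.rpow_le_rpow_of_exponent_le (by norm_num) ?_
        push_cast
        linarith
      · have h1 : √(4 * p * (1 - p)) ≤ 2 ^ (-4 * (β + 1 / n)) := by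
          rw [Real.sqrt_le_left (by positivity), ← Real.rpow_natCast, ← Real.rpow_mul (by norm_num)]
          convert hpq using 2
          push_cast
          ring
        -- The `n` repetitions turn `1 / n` into the constant 4, which covers the union bound over
        -- two bits and the constant 2; `4 * n ≥ 7` covers the multiple of `β`.
        have h2 : √(4 * p * (1 - p)) ^ n ≤ 2 ^ (-4 * (n * β + 1)) := by
          refine (pow_le_pow_left₀ (Real.sqrt_nonneg _) h1 n).trans (le_of_eq ?_)
          rw [← Real.rpow_natCast, ← Real.rpow_mul (by norm_num)]
          congr 1
          field_simp
        calc 2 * √(4 * p * (1 - p)) ^ n ≤ 2 * 2 ^ (-4 * (n * β + 1)) := by gcongr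
          _ = 2 ^ (1 + -4 * (n * β + 1)) := by rw [Real.rpow_add (by norm_num), Real.rpow_one]
          _ ≤ _ := Real.rpow_le_rpow_of_exponent_le (by norm_num) (by nlinarith)
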